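/- Let $p$ be a prime and let $R$ be a nonzero $C_p$-Tambara functor, with restriction $\mathrm{Res}$, transfer $\mathrm{Tr}$, norm $\mathrm{Nm}$, and with the action of $C_p$ on $R(C_p/e)$. Write $\Phi = R(C_p/C_p)/\mathrm{Tr}$ for the quotient of $R(C_p/C_p)$ by the image of the transfer. The ghost of $R$ is the $C_p$-Tambara functor $\mathrm{ghost}(R)$ with $\mathrm{ghost}(R)(C_p/e)=R(C_p/e)$ and $\mathrm{ghost}(R)(C_p/C_p)=R(C_p/e)^{C_p}\times\Phi$, with restriction $(a,b)\mapsto a$, transfer $x\mapsto(\sum_{g} gx,0)$ and norm $x\mapsto(\prod_g gx,[\mathrm{Nm}\,x])$. For ideals $\mathfrak p\subseteq R(C_p/e)$ and $\mathfrak q\subseteq\Phi$, a Tambara ideal of $\mathrm{ghost}(R)$ is called $(\mathfrak p;\mathfrak q)$ if it equals $\mathfrak p$ in level $C_p/e$ and $\mathfrak p^{C_p}\times\mathfrak q$ in level $C_p/C_p$, where $\mathfrak p^{C_p}=\mathfrak p\cap R(C_p/e)^{C_p}$. An ideal $\mathfrak p$ of $R(C_p/e)$ is $C_p$-prime if it is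 proper, $C_p$-invariant, and $x\cdot gy\in\mathfrak p$ for all $g\in C_p$ implies $x\in\mathfrak p$ or $y\in\mathfrak p$. The Nakaoka spectrum $\mathrm{Spec}(T)$ of a $C_p$-Tambara functor $T$ is the set of its prime Tambara ideals (the proper Tambara ideals $P$ such that $I\cdot J\subseteq P$ implies $I\subseteq P$ or $J\subseteq P$, where $I\cdot J$ is the Tambara ideal generated by the levelwise products), with the topology whose closed sets are generated by the sets $V(I)=\{P : I\subseteq P\}$ for Tambara ideals $I$. Its $e$-th stratum is the image of the map $\mathrm{Spec}(T(C_p/e))\to\mathrm{Spec}(\mathrm{CoInd}_e^{C_p}T(C_p/e))\to\mathrm{Spec}(T)$ that sends a prime ideal $\mathfrak r$ of the ring $T(C_p/e)$ to the contraction of $\mathrm{CoInd}_e^{C_p}\mathfrak r$ along the adjunction unit $T\to\mathrm{CoInd}_e^{C_p}\mathrm{Res}_e^{C_p}T$. Then: 1. A prime ideal of $\mathrm{ghost}(R)$ of the form $(\mathfrak p;\mathfrak q)$ lies in the $e$-th stratum of $\mathrm{Spec}(\mathrm{ghost}(R))$ if and only if $\mathfrak q=\Phi$. A prime ideal of $\mathrm{ghost}(R)$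 lies in the $e$-th stratum if and only if it is equal to $(\mathfrak p;\Phi)$ for some $C_p$-prime ideal $\mathfrak p$ of $R(C_p/e)$, and for every $C_p$-prime ideal $\mathfrak p$ of $R(C_p/e)$ there is a prime ideal $(\mathfrak p;\Phi)$ of $\mathrm{ghost}(R)$. 2. If $\mathrm{Tr}:R(C_p/e)\to R(C_p/C_p)$ is not surjective, then the $e$-th stratum of $\mathrm{Spec}(\mathrm{ghost}(R))$ is not open. 3. If the ring $R(C_p/e)^{C_p}$ has finitely many minimal prime ideals, then the $e$-th stratum of $\mathrm{Spec}(\mathrm{ghost}(R))$ is closed. -/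

import Mathlib

universe u

/-- The cyclic group of order `p`, written multiplicatively. -/
abbrev Cp (p : ℕ) : Type := Multiplicative (ZMod p)

section Combinatorics

open scoped Pointwise

/-- The monomial `∏_{g ∈ S} g a * ∏_{g ∉ S} g b` in a commutative ring with `C_p`-action. -/
def crossMonomial {p : ℕ} [Fact p.Prime] {B : Type u} [CommRing B] [MulSemiringAction (Cp p) B]
    (a b : B) (S : Finset (Cp p)) : B :=
  (∏ g ∈ S, g • a) * ∏ g ∈ Finset.univ \ S, g • b

/-- A chosen representative of the orbit of `S` under the translation action of `C_p` on its
subsets. -/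
noncomputable def orbitRep {p : ℕ} [Fact p.Prime] (S : Finset (Cp p)) : Finset (Cp p) :=
  (Quotient.mk (MulAction.orbitRel (Cp p) (Finset (Cp p))) S).out

/-- A system of representatives, one for each translation orbit, of the subsets of `C_p` other than
the empty set and the whole group. -/
noncomputable def crossReps (p : ℕ) [Fact p.Prime] : Finset (Finset (Cp p)) :=
  (Finset.univ.filter fun S : Finset (Cp p) => S ≠ ∅ ∧ S ≠ Finset.univ).image orbitRep

theorem exists_smul_orbitRep {p : ℕ} [Fact p.Prime] (S : Finset (Cp p)) :
    ∃ g : Cp p, g • orbitRep S = S := by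
  have h : (MulAction.orbitRel (Cp p) (Finset (Cp p))).r (orbitRep S) S :=
    Quotient.exact (Quotient.out_eq (Quotient.mk (MulAction.orbitRel (Cp p) (Finset (Cp p))) S))
  obtain ⟨g, hg⟩ := MulAction.orbitRel_apply.1 h
  exact ⟨g⁻¹, by rw [← hg]; simp⟩

theorem orbitRep_smul {p : ℕ} [Fact p.Prime] (g : Cp p) (S : Finset (Cp p)) :
    orbitRep (g • S) = orbitRep S := by
  unfold orbitRep
  congr 1
  exact Quotient.sound ⟨g, rfl⟩

theorem smul_crossMonomial {p : ℕ} [Fact p.Prime] {B : Type u} [CommRing B]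
    [MulSemiringAction (Cp p) B] (a b : B) (h : Cp p) (S : Finset (Cp p)) :
    h • crossMonomial a b S = crossMonomial a b (h • S) := by
  have key : ∀ (c : B) (T : Finset (Cp p)), h • ∏ g ∈ T, g • c = ∏ g ∈ h • T, g • c := by
    intro c T
    rw [Finset.smul_prod']
    refine Finset.prod_nbij (fun g => h * g) ?_ ?_ ?_ ?_
    · intro g hg
      exact Finset.smul_mem_smul_finset hg
    · intro x _ y _ hxy
      exact mul_left_cancel hxy
    · intro x hx
      obtain ⟨y, hy, rfl⟩ := Finset.mem_smul_finset.1 (Finset.mem_coe.1 hx)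
      exact ⟨y, hy, rfl⟩
    · intro g _
      rw [smul_smul]
  unfold crossMonomial
  rw [smul_mul', key, key, Finset.smul_finset_sdiff, Finset.smul_finset_univ]

/-- Translation acts freely on the subsets of `C_p` other than `∅` and the whole group. -/
theorem eq_one_of_smul_eq {p : ℕ} [Fact p.Prime] {S : Finset (Cp p)} (h0 : S ≠ ∅)
    (h1 : S ≠ Finset.univ) {g : Cp p} (hg : g • S = S) : g = 1 := by
  by_contra hne
  apply h1
  have hcard : Nat.card (Cp p) = p := by simp
  have hstab : ∀ h : Cp p, h • S = S := by
    intro h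
    have hz : h ∈ Subgroup.zpowers g := mem_zpowers_of_prime_card hcard hne
    have : Subgroup.zpowers g ≤ MulAction.stabilizer (Cp p) S := by
      rw [Subgroup.zpowers_le]; exact hg
    exact this hz
  obtain ⟨x, hx⟩ := Finset.nonempty_iff_ne_empty.2 h0
  refine Finset.eq_univ_iff_forall.2 fun y => ?_
  have := Finset.smul_mem_smul_finset (a := y * x⁻¹) hx
  rw [hstab] at this
  simpa using this

theorem smul_proper {p : ℕ} [Fact p.Prime] (g : Cp p) {S : Finset (Cp p)}
    (h : S ≠ ∅ ∧ S ≠ Finset.univ) : g • S ≠ ∅ ∧ g • S ≠ Finset.univ := by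
  refine ⟨fun h' => h.1 ?_, fun h' => h.2 ?_⟩
  · simpa using h'
  · have := congrArg (fun T => g⁻¹ • T) h'
    simpa [Finset.smul_finset_univ] using this

theorem crossReps_spec {p : ℕ} [Fact p.Prime] {S : Finset (Cp p)} (hS : S ∈ crossReps p) :
    (S ≠ ∅ ∧ S ≠ Finset.univ) ∧ orbitRep S = S := by
  obtain ⟨T, hT, rfl⟩ := Finset.mem_image.1 hS
  obtain ⟨g, hg⟩ := exists_smul_orbitRep T
  have hT' := (Finset.mem_filter.1 hT).2
  have e : orbitRep T = g⁻¹ • T := eq_inv_smul_iff.2 hg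
  refine ⟨?_, ?_⟩
  · rw [e]; exact smul_proper _ hT'
  · rw [e, orbitRep_smul, e]

/-- The product over `C_p` of the conjugates of a sum. -/
theorem prod_smul_add {p : ℕ} [Fact p.Prime] {B : Type u} [CommRing B]
    [MulSemiringAction (Cp p) B] (a b : B) :
    ∏ g : Cp p, g • (a + b) = ∏ g : Cp p, g • a + ∏ g : Cp p, g • b +
      ∑ S ∈ crossReps p, ∑ g : Cp p, g • crossMonomial a b S := by
  have h1 : ∏ g : Cp p, g • (a + b) = ∑ S : Finset (Cp p), crossMonomial a b S := by
    simp only [smul_add]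
    rw [Finset.prod_add, Finset.powerset_univ]
    rfl
  have h2 : ∑ S ∈ crossReps p, ∑ g : Cp p, g • crossMonomial a b S =
      ∑ S ∈ Finset.univ.filter (fun S : Finset (Cp p) => S ≠ ∅ ∧ S ≠ Finset.univ),
        crossMonomial a b S := by
    rw [← Finset.sum_product']
    refine Finset.sum_nbij (fun x => x.2 • x.1) ?_ ?_ ?_ ?_
    · rintro ⟨S, g⟩ hx
      have hS := (crossReps_spec (Finset.mem_product.1 hx).1).1
      exact Finset.mem_filter.2 ⟨Finset.mem_univ _, smul_proper g hS⟩
    · rintro ⟨S, g⟩ hx ⟨T, h⟩ hy hxy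
      have hS := crossReps_spec (Finset.mem_product.1 hx).1
      have hT := crossReps_spec (Finset.mem_product.1 hy).1
      simp only at hxy hS hT
      have e : S = T := by
        rw [← hS.2, ← hT.2, ← orbitRep_smul g S, hxy, orbitRep_smul]
      subst e
      have : (h⁻¹ * g) • S = S := by rw [mul_smul, hxy]; simp
      have := eq_one_of_smul_eq hS.1.1 hS.1.2 this
      rw [inv_mul_eq_one] at this
      rw [this]
    · intro S hS
      obtain ⟨g, hg⟩ := exists_smul_orbitRep S
      refine ⟨(orbitRep S, g), ?_, hg⟩
      simp only [Finset.coe_product, Set.mem_prod, Finset.mem_coe, Finset.mem_univ, and_true]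
      exact Finset.mem_image_of_mem _ hS
    · rintro ⟨S, g⟩ _
      exact smul_crossMonomial a b g S
  have hne : (∅ : Finset (Cp p)) ≠ Finset.univ := Finset.univ_nonempty.ne_empty.symm
  have h3 : (Finset.univ.filter fun S : Finset (Cp p) => ¬ (S ≠ ∅ ∧ S ≠ Finset.univ)) =
      {Finset.univ, ∅} := by
    ext S
    simp only [Finset.mem_filter, Finset.mem_univ, true_and, Finset.mem_insert,
      Finset.mem_singleton]
    tauto
  rw [h1, h2, ← Finset.sum_filter_not_add_sum_filter Finset.univ
    (fun S : Finset (Cp p) => S ≠ ∅ ∧ S ≠ Finset.univ), h3, Finset.sum_pair hne.symm]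
  simp [crossMonomial]

end Combinatorics

/-- A `C_p`-Tambara functor, presented by its Lewis diagram: commutative rings `lvlG = R(C_p/C_p)`
and `lvlE = R(C_p/e)`, the latter with an action of the Weyl group `C_p`, together with
restriction, transfer and norm. -/
structure CpTambara (p : ℕ) [Fact p.Prime] where
  lvlG : Type u
  lvlE : Type u
  [ringG : CommRing lvlG]
  [ringE : CommRing lvlE]
  [act : MulSemiringAction (Cp p) lvlE]
  res : lvlG →+* lvlE
  tr : lvlE →+ lvlG
  nm : lvlE →* lvlG
  smul_res : ∀ (g : Cp p) (x : lvlG), g • res x = res x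
  tr_smul : ∀ (g : Cp p) (x : lvlE), tr (g • x) = tr x
  nm_smul : ∀ (g : Cp p) (x : lvlE), nm (g • x) = nm x
  res_tr : ∀ x : lvlE, res (tr x) = ∑ g : Cp p, g • x
  res_nm : ∀ x : lvlE, res (nm x) = ∏ g : Cp p, g • x
  /-- Frobenius reciprocity -/
  tr_mul_res : ∀ (x : lvlE) (y : lvlG), tr (x * res y) = tr x * y
  nm_zero : nm 0 = 0
  /-- Tambara reciprocity: the norm of a sum -/
  nm_add : ∀ a b : lvlE,
    nm (a + b) = nm a + nm b + ∑ S ∈ crossReps p, tr (crossMonomial a b S)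

namespace CpTambara

attribute [instance] ringG ringE act

/-- `R` is not the zero Tambara functor. -/
def IsNonzero {p : ℕ} [Fact p.Prime] (R : CpTambara.{u} p) : Prop :=
  Nontrivial R.lvlG ∨ Nontrivial R.lvlE

/-- Morphisms of `C_p`-Tambara functors. -/
structure Hom {p : ℕ} [Fact p.Prime] (R S : CpTambara.{u} p) where
  mapG : R.lvlG →+* S.lvlG
  mapE : R.lvlE →+* S.lvlE
  map_smul : ∀ (g : Cp p) (x : R.lvlE), mapE (g • x) = g • mapE x
  map_res : ∀ x : R.lvlG, mapE (R.res x) = S.res (mapG x)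
  map_tr : ∀ x : R.lvlE, mapG (R.tr x) = S.tr (mapE x)
  map_nm : ∀ x : R.lvlE, mapG (R.nm x) = S.nm (mapE x)

/-- Tambara ideals. -/
@[ext]
structure TIdeal {p : ℕ} [Fact p.Prime] (R : CpTambara.{u} p) where
  idealG : Ideal R.lvlG
  idealE : Ideal R.lvlE
  tr_mem : ∀ x ∈ idealE, R.tr x ∈ idealG
  nm_mem : ∀ x ∈ idealE, R.nm x ∈ idealG
  res_mem : ∀ x ∈ idealG, R.res x ∈ idealE
  smul_mem : ∀ (g : Cp p), ∀ x ∈ idealE, g • x ∈ idealE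

namespace TIdeal

instance {p : ℕ} [Fact p.Prime] (R : CpTambara.{u} p) : PartialOrder (TIdeal R) where
  le I J := I.idealG ≤ J.idealG ∧ I.idealE ≤ J.idealE
  le_refl I := ⟨le_refl _, le_refl _⟩
  le_trans I J K h h' := ⟨h.1.trans h'.1, h.2.trans h'.2⟩
  le_antisymm I J h h' := TIdeal.ext (le_antisymm h.1 h'.1) (le_antisymm h.2 h'.2)

/-- The unit ideal. -/
instance {p : ℕ} [Fact p.Prime] (R : CpTambara.{u} p) : Top (TIdeal R) where
  top := ⟨⊤, ⊤, by simp, by simp, by simp, by simp⟩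

/-- The smallest Tambara ideal containing given subsets of the two levels. -/
def span {p : ℕ} [Fact p.Prime] (R : CpTambara.{u} p) (A : Set R.lvlG) (B : Set R.lvlE) :
    TIdeal R where
  idealG := ⨅ K : {K : TIdeal R // A ⊆ K.idealG ∧ B ⊆ K.idealE}, K.1.idealG
  idealE := ⨅ K : {K : TIdeal R // A ⊆ K.idealG ∧ B ⊆ K.idealE}, K.1.idealE
  tr_mem x hx := by
    simp only [Submodule.mem_iInf] at hx ⊢
    exact fun K => K.1.tr_mem x (hx K)
  nm_mem x hx := by
    simp only [Submodule.mem_iInf] at hx ⊢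
    exact fun K => K.1.nm_mem x (hx K)
  res_mem x hx := by
    simp only [Submodule.mem_iInf] at hx ⊢
    exact fun K => K.1.res_mem x (hx K)
  smul_mem g x hx := by
    simp only [Submodule.mem_iInf] at hx ⊢
    exact fun K => K.1.smul_mem g x (hx K)

/-- The product of Tambara ideals: the Tambara ideal generated by the levelwise products. -/
instance {p : ℕ} [Fact p.Prime] (R : CpTambara.{u} p) : Mul (TIdeal R) where
  mul I J := span R (I.idealG * J.idealG : Ideal R.lvlG) (I.idealE * J.idealE : Ideal R.lvlE)

/-- Prime Tambara ideals. -/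
def IsPrime {p : ℕ} [Fact p.Prime] {R : CpTambara.{u} p} (P : TIdeal R) : Prop :=
  P ≠ ⊤ ∧ ∀ I J : TIdeal R, I * J ≤ P → I ≤ P ∨ J ≤ P

theorem mul_le_iff {p : ℕ} [Fact p.Prime] {R : CpTambara.{u} p} {I J P : TIdeal R} :
    I * J ≤ P ↔ I.idealG * J.idealG ≤ P.idealG ∧ I.idealE * J.idealE ≤ P.idealE := by
  constructor
  · intro h
    refine ⟨le_trans ?_ h.1, le_trans ?_ h.2⟩
    · exact le_iInf fun K => K.2.1
    · exact le_iInf fun K => K.2.2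
  · intro h
    exact ⟨iInf_le_of_le ⟨P, h.1, h.2⟩ le_rfl, iInf_le_of_le ⟨P, h.1, h.2⟩ le_rfl⟩

/-- The contraction of a Tambara ideal along a morphism. -/
def comap {p : ℕ} [Fact p.Prime] {R S : CpTambara.{u} p} (f : Hom R S) (J : TIdeal S) :
    TIdeal R where
  idealG := J.idealG.comap f.mapG
  idealE := J.idealE.comap f.mapE
  tr_mem x hx := by
    rw [Ideal.mem_comap] at hx ⊢
    rw [f.map_tr]; exact J.tr_mem _ hx
  nm_mem x hx := by
    rw [Ideal.mem_comap] at hx ⊢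
    rw [f.map_nm]; exact J.nm_mem _ hx
  res_mem x hx := by
    rw [Ideal.mem_comap] at hx ⊢
    rw [f.map_res]; exact J.res_mem _ hx
  smul_mem g x hx := by
    rw [Ideal.mem_comap] at hx ⊢
    rw [f.map_smul]; exact J.smul_mem g _ hx

/-- An ideal of the underlying ring that is stable under `C_p` contains every mixed term with one
entry in it. -/
theorem crossMonomial_mem {p : ℕ} [Fact p.Prime] {R : CpTambara.{u} p} (I : Ideal R.lvlE)
    (hI : ∀ (g : Cp p), ∀ x ∈ I, g • x ∈ I) {a : R.lvlE} (ha : a ∈ I) (b : R.lvlE)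
    {S : Finset (Cp p)} (hS : S ∈ crossReps p) : crossMonomial a b S ∈ I := by
  obtain ⟨g, hg⟩ := Finset.nonempty_iff_ne_empty.2 (crossReps_spec hS).1.1
  refine I.mul_mem_right _ ?_
  rw [← Finset.mul_prod_erase _ _ hg]
  exact I.mul_mem_right _ (hI g a ha)

/-- The extension of a Tambara ideal along a morphism. -/
def map {p : ℕ} [Fact p.Prime] {R S : CpTambara.{u} p} (f : Hom R S) (I : TIdeal R) :
    TIdeal S :=
  have hsmul : ∀ (g : Cp p), ∀ x ∈ I.idealE.map f.mapE, g • x ∈ I.idealE.map f.mapE := by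
    intro g x hx
    have hle : I.idealE.map f.mapE ≤
        (I.idealE.map f.mapE).comap (MulSemiringAction.toRingHom (Cp p) S.lvlE g) := by
      rw [Ideal.map_le_iff_le_comap]
      intro y hy
      rw [Ideal.mem_comap, Ideal.mem_comap, MulSemiringAction.toRingHom_apply, ← f.map_smul]
      exact Ideal.mem_map_of_mem _ (I.smul_mem g y hy)
    exact hle hx
  have htr : ∀ x ∈ I.idealE.map f.mapE, S.tr x ∈ I.idealG.map f.mapG ⊔
      Ideal.span (S.tr '' (I.idealE.map f.mapE)) := fun x hx =>
    Ideal.mem_sup_right (Ideal.subset_span ⟨x, hx, rfl⟩)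
  { idealG := I.idealG.map f.mapG ⊔ Ideal.span (S.tr '' (I.idealE.map f.mapE))
    idealE := I.idealE.map f.mapE
    tr_mem := htr
    nm_mem := by
      intro x hx
      have hx' := hx
      rw [Ideal.map] at hx'
      induction hx' using Submodule.span_induction with
      | mem y hy =>
        obtain ⟨z, hz, rfl⟩ := hy
        rw [← f.map_nm]
        exact Ideal.mem_sup_left (Ideal.mem_map_of_mem _ (I.nm_mem z hz))
      | zero => rw [S.nm_zero]; exact Ideal.zero_mem _
      | add y z hy hz ihy ihz =>
        rw [S.nm_add]
        refine Ideal.add_mem _ (Ideal.add_mem _ (ihy hy) (ihz hz)) (Ideal.sum_mem _ ?_)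
        intro T hT
        exact htr _ (crossMonomial_mem _ hsmul hy z hT)
      | smul a y hy ih =>
        rw [smul_eq_mul, map_mul]
        exact Ideal.mul_mem_left _ _ (ih hy)
    res_mem := by
      intro x hx
      have hle : I.idealG.map f.mapG ⊔ Ideal.span (S.tr '' (I.idealE.map f.mapE)) ≤
          (I.idealE.map f.mapE).comap S.res := by
        refine sup_le ?_ ?_
        · rw [Ideal.map_le_iff_le_comap]
          intro y hy
          rw [Ideal.mem_comap, Ideal.mem_comap, ← f.map_res]
          exact Ideal.mem_map_of_mem _ (I.res_mem y hy)
        · rw [Ideal.span_le]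
          rintro _ ⟨y, hy, rfl⟩
          rw [SetLike.mem_coe, Ideal.mem_comap, S.res_tr]
          exact Ideal.sum_mem _ fun g _ => hsmul g y hy
      exact hle hx
    smul_mem := hsmul }

theorem IsPrime.comap {p : ℕ} [Fact p.Prime] {R S : CpTambara.{u} p} (f : Hom R S)
    {P : TIdeal S} (hP : P.IsPrime) : (P.comap f).IsPrime := by
  refine ⟨fun h => hP.1 ?_, fun I J hIJ => ?_⟩
  · have hG : (1 : R.lvlG) ∈ (P.comap f).idealG := by rw [h]; exact Submodule.mem_top
    have hE : (1 : R.lvlE) ∈ (P.comap f).idealE := by rw [h]; exact Submodule.mem_top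
    have hG' : f.mapG 1 ∈ P.idealG := hG
    have hE' : f.mapE 1 ∈ P.idealE := hE
    rw [map_one] at hG' hE'
    exact TIdeal.ext ((Ideal.eq_top_iff_one _).2 hG') ((Ideal.eq_top_iff_one _).2 hE')
  · rw [mul_le_iff] at hIJ
    have hle : ∀ K : TIdeal R, K.map f ≤ P → K ≤ P.comap f := by
      intro K hK
      refine ⟨?_, ?_⟩
      · exact Ideal.map_le_iff_le_comap.1 (le_trans le_sup_left hK.1)
      · exact Ideal.map_le_iff_le_comap.1 hK.2
    refine (hP.2 (I.map f) (J.map f) ?_).imp (hle I) (hle J)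
    rw [mul_le_iff]
    have hE : (I.map f).idealE * (J.map f).idealE ≤ P.idealE := by
      change I.idealE.map f.mapE * J.idealE.map f.mapE ≤ P.idealE
      rw [← Ideal.map_mul, Ideal.map_le_iff_le_comap]
      exact hIJ.2
    refine ⟨?_, hE⟩
    have hG : I.idealG.map f.mapG * J.idealG.map f.mapG ≤ P.idealG := by
      rw [← Ideal.map_mul, Ideal.map_le_iff_le_comap]
      exact hIJ.1
    have hl : ∀ x ∈ (I.map f).idealE, ∀ y ∈ (J.map f).idealG, S.tr x * y ∈ P.idealG := by
      intro x hx y hy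
      rw [← S.tr_mul_res]
      exact P.tr_mem _ (hE (Ideal.mul_mem_mul hx ((J.map f).res_mem y hy)))
    have hr : ∀ x ∈ (I.map f).idealG, ∀ y ∈ (J.map f).idealE, x * S.tr y ∈ P.idealG := by
      intro x hx y hy
      rw [mul_comm, ← S.tr_mul_res, mul_comm]
      exact P.tr_mem _ (hE (Ideal.mul_mem_mul ((I.map f).res_mem x hx) hy))
    change (I.idealG.map f.mapG ⊔ Ideal.span (S.tr '' (I.idealE.map f.mapE))) *
      (J.map f).idealG ≤ P.idealG
    rw [Ideal.sup_mul]
    refine sup_le ?_ ?_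
    · change I.idealG.map f.mapG *
        (J.idealG.map f.mapG ⊔ Ideal.span (S.tr '' (J.idealE.map f.mapE))) ≤ P.idealG
      rw [Ideal.mul_sup]
      refine sup_le hG ?_
      rw [Ideal.mul_le]
      intro x hx y hy
      have : Ideal.span (S.tr '' (J.idealE.map f.mapE)) ≤
          Submodule.comap (LinearMap.mulLeft S.lvlG x) P.idealG := by
        rw [Submodule.span_le]
        rintro _ ⟨z, hz, rfl⟩
        exact hr x (Ideal.mem_sup_left hx) z hz
      exact this hy
    · rw [Ideal.mul_le]
      intro x hx y hy
      have : Ideal.span (S.tr '' (I.idealE.map f.mapE)) ≤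
          Submodule.comap (LinearMap.mulRight S.lvlG y) P.idealG := by
        rw [Submodule.span_le]
        rintro _ ⟨z, hz, rfl⟩
        exact hl z hz y hy
      exact this hx

end TIdeal

/-- The Nakaoka spectrum: the set of prime Tambara ideals. -/
structure Spec {p : ℕ} [Fact p.Prime] (R : CpTambara.{u} p) where
  ideal : TIdeal R
  isPrime : ideal.IsPrime

/-- The basic closed subset `V(I)`. -/
def zeroLocus {p : ℕ} [Fact p.Prime] {R : CpTambara.{u} p} (I : TIdeal R) : Set (Spec R) :=
  {P | I ≤ P.ideal}

/-- The topology on the Nakaoka spectrum whose closed sets are generated by the `V(I)`. -/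
instance {p : ℕ} [Fact p.Prime] (R : CpTambara.{u} p) : TopologicalSpace (Spec R) :=
  TopologicalSpace.generateFrom {U | ∃ I : TIdeal R, U = (zeroLocus I)ᶜ}

/-- The map on Nakaoka spectra induced by a morphism. -/
def Spec.comap {p : ℕ} [Fact p.Prime] {R S : CpTambara.{u} p} (f : Hom R S) (P : Spec S) :
    Spec R :=
  ⟨P.ideal.comap f, P.isPrime.comap f⟩

/-- The action of `C_p` on functions `C_p → S` by translation of the argument. -/
abbrev coindAction (p : ℕ) (S : Type u) [CommRing S] :
    MulSemiringAction (Cp p) (Cp p → S) where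
  smul h f := fun g => f (g * h)
  one_smul f := funext fun g => congrArg f (mul_one g)
  mul_smul h k f := funext fun g => congrArg f (mul_assoc g h k).symm
  smul_zero _ := rfl
  smul_add _ _ _ := rfl
  smul_one _ := rfl
  smul_mul _ _ _ := rfl

/-- The coinduction of a commutative ring `S` (that is, of a Tambara functor for the trivial group)
to `C_p`: it is `S` in level `C_p/C_p` and `Map(C_p, S)` in level `C_p/e`. -/
def coind (p : ℕ) [Fact p.Prime] (S : Type u) [CommRing S] : CpTambara.{u} p :=
  letI : MulSemiringAction (Cp p) (Cp p → S) := coindAction p S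
  have smul_def : ∀ (h : Cp p) (f : Cp p → S) (g : Cp p), (h • f) g = f (g * h) :=
    fun _ _ _ => rfl
  { lvlG := S
    lvlE := Cp p → S
    res := Pi.constRingHom (Cp p) S
    tr := { toFun := fun f => ∑ g, f g
            map_zero' := by simp
            map_add' := fun f h => by simp [Finset.sum_add_distrib] }
    nm := { toFun := fun f => ∏ g, f g
            map_one' := by simp
            map_mul' := fun f h => by simp [Finset.prod_mul_distrib] }
    smul_res := fun _ _ => rfl
    tr_smul := fun h f => Fintype.sum_equiv (Equiv.mulRight h) _ _ fun _ => rfl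
    nm_smul := fun h f => Fintype.prod_equiv (Equiv.mulRight h) _ _ fun _ => rfl
    res_tr := fun f => by
      funext k
      rw [Finset.sum_apply]
      exact Fintype.sum_equiv (Equiv.mulLeft k⁻¹) _ _ fun g => by simp [smul_def]
    res_nm := fun f => by
      funext k
      rw [Finset.prod_apply]
      exact Fintype.prod_equiv (Equiv.mulLeft k⁻¹) _ _ fun g => by simp [smul_def]
    tr_mul_res := fun f y => by
      change ∑ g, f g * y = (∑ g, f g) * y
      rw [Finset.sum_mul]
    nm_zero := Finset.prod_eq_zero (Finset.mem_univ 1) rfl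
    nm_add := fun a b => by
      have h := congrFun (prod_smul_add (p := p) a b) 1
      simp only [Finset.prod_apply, Finset.sum_apply, Pi.add_apply, smul_def, one_mul] at h
      exact h }

/-- The coinduction of an ideal of `S`. -/
def coindIdeal (p : ℕ) [Fact p.Prime] {S : Type u} [CommRing S] (q : Ideal S) :
    TIdeal (coind p S) where
  idealG := q
  idealE := Ideal.pi fun _ : Cp p => q
  tr_mem _ hx := Ideal.sum_mem q fun g _ => hx g
  nm_mem _ hx := Ideal.prod_mem q (i := (1 : Cp p)) (Finset.mem_univ _) (hx 1)
  res_mem _ hx := fun _ => hx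
  smul_mem g _ hx := fun k => hx (k * g)

theorem coindIdeal_isPrime (p : ℕ) [Fact p.Prime] {S : Type u} [CommRing S] (q : Ideal S)
    [hq : q.IsPrime] : (coindIdeal p q).IsPrime := by
  refine ⟨fun h => hq.ne_top (congrArg TIdeal.idealG h), fun I J hIJ => ?_⟩
  rw [TIdeal.mul_le_iff] at hIJ
  have key : ∀ K : TIdeal (coind p S), ¬ K ≤ coindIdeal p q →
      ∃ f : Cp p → S, f ∈ K.idealE ∧ f 1 ∉ q := by
    intro K hK
    by_contra hcon
    push Not at hcon
    refine hK ⟨fun x hx => hcon _ (K.res_mem x hx), fun f hf g => ?_⟩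
    have := hcon _ (K.smul_mem g f hf)
    change f (1 * g) ∈ q at this
    rwa [one_mul] at this
  by_contra hcon
  push Not at hcon
  obtain ⟨f, hf, hf1⟩ := key I hcon.1
  obtain ⟨h, hh, hh1⟩ := key J hcon.2
  exact (hq.mem_or_mem (hIJ.2 (Ideal.mul_mem_mul hf hh) 1)).elim hf1 hh1

/-- The unit `R → CoInd_e Res_e R` of the adjunction between restriction to the trivial group and
coinduction. -/
def coindUnit {p : ℕ} [Fact p.Prime] (R : CpTambara.{u} p) : Hom R (coind p R.lvlE) where
  mapG := R.res
  mapE := RingHom.pi fun g => MulSemiringAction.toRingHom (Cp p) R.lvlE g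
  map_smul h x := funext fun g => smul_smul g h x
  map_res x := funext fun g => R.smul_res g x
  map_tr x := R.res_tr x
  map_nm x := R.res_nm x

/-- The map `Spec(Res_e R) → Spec(CoInd_e Res_e R) → Spec(R)`, where the restriction of `R` to the
trivial group is the commutative ring `R(C_p/e)`. -/
def specRes {p : ℕ} [Fact p.Prime] (R : CpTambara.{u} p) (q : PrimeSpectrum R.lvlE) : Spec R :=
  Spec.comap R.coindUnit
    ⟨coindIdeal p q.asIdeal, haveI := q.isPrime; coindIdeal_isPrime p q.asIdeal⟩

/-- The stratum of `Spec(R)` indexed by the trivial subgroup. -/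
def eStratum {p : ℕ} [Fact p.Prime] (R : CpTambara.{u} p) : Set (Spec R) :=
  Set.range R.specRes

/-- The fixed-point ring `R(C_p/e)^{C_p}`. -/
abbrev fixedE {p : ℕ} [Fact p.Prime] (R : CpTambara.{u} p) : Subring R.lvlE :=
  FixedPoints.subring R.lvlE (Cp p)

/-- The image of the transfer, an ideal of `R(C_p/C_p)`. -/
def trIdeal {p : ℕ} [Fact p.Prime] (R : CpTambara.{u} p) : Ideal R.lvlG where
  carrier := Set.range R.tr
  add_mem' := by
    rintro _ _ ⟨x, rfl⟩ ⟨y, rfl⟩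
    exact ⟨x + y, map_add _ _ _⟩
  zero_mem' := ⟨0, map_zero _⟩
  smul_mem' := by
    rintro c _ ⟨x, rfl⟩
    exact ⟨x * R.res c, by rw [R.tr_mul_res, smul_eq_mul, mul_comm]⟩

/-- The ring `R(C_p/C_p)/Tr`. -/
abbrev geomFixed {p : ℕ} [Fact p.Prime] (R : CpTambara.{u} p) : Type u :=
  R.lvlG ⧸ R.trIdeal

/-- The ghost of `R`: it is `R(C_p/e)` in level `C_p/e` and `R(C_p/e)^{C_p} × R(C_p/C_p)/Tr` in
level `C_p/C_p`, with restriction the first projection, transfer `x ↦ (∑ g x, 0)` and norm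
`x ↦ (∏ g x, [Nm x])`. -/
def ghost {p : ℕ} [Fact p.Prime] (R : CpTambara.{u} p) : CpTambara.{u} p where
  lvlG := R.fixedE × R.geomFixed
  lvlE := R.lvlE
  res := R.fixedE.subtype.comp (RingHom.fst _ _)
  tr :=
    { toFun := fun x => (⟨∑ g : Cp p, g • x, fun h => by rw [← R.res_tr, R.smul_res]⟩, 0)
      map_zero' := by ext <;> simp
      map_add' := fun x y => by ext <;> simp [Finset.sum_add_distrib] }
  nm :=
    { toFun := fun x => (⟨∏ g : Cp p, g • x, fun h => by rw [← R.res_nm, R.smul_res]⟩,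
        Ideal.Quotient.mk _ (R.nm x))
      map_one' := by ext <;> simp
      map_mul' := fun x y => by ext <;> simp [Finset.prod_mul_distrib] }
  smul_res g x := x.1.2 g
  tr_smul h x := by
    refine Prod.ext (Subtype.ext ?_) rfl
    change ∑ g : Cp p, g • h • x = ∑ g : Cp p, g • x
    rw [← R.res_tr, ← R.res_tr, R.tr_smul]
  nm_smul h x := by
    refine Prod.ext (Subtype.ext ?_) ?_
    · change ∏ g : Cp p, g • h • x = ∏ g : Cp p, g • x
      rw [← R.res_nm, ← R.res_nm, R.nm_smul]
    · change Ideal.Quotient.mk _ (R.nm (h • x)) = Ideal.Quotient.mk _ (R.nm x)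
      rw [R.nm_smul]
  res_tr _ := rfl
  res_nm _ := rfl
  tr_mul_res x y := by
    refine Prod.ext (Subtype.ext ?_) (zero_mul _).symm
    change ∑ g : Cp p, g • (x * (y.1 : R.lvlE)) = (∑ g : Cp p, g • x) * (y.1 : R.lvlE)
    rw [Finset.sum_mul]
    refine Finset.sum_congr rfl fun g _ => ?_
    rw [smul_mul', y.1.2 g]
  nm_zero := by
    refine Prod.ext (Subtype.ext ?_) ?_
    · change ∏ g : Cp p, g • (0 : R.lvlE) = 0
      rw [← R.res_nm, R.nm_zero, map_zero]
    · change Ideal.Quotient.mk _ (R.nm 0) = 0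
      rw [R.nm_zero, map_zero]
  nm_add a b := by
    refine Prod.ext (Subtype.ext ?_) ?_
    · simp only [Prod.fst_add, Prod.fst_sum, Subring.coe_add, AddSubmonoidClass.coe_finsetSum]
      exact prod_smul_add a b
    · simp only [Prod.snd_add, Prod.snd_sum]
      change Ideal.Quotient.mk R.trIdeal (R.nm (a + b)) = Ideal.Quotient.mk R.trIdeal (R.nm a) +
        Ideal.Quotient.mk R.trIdeal (R.nm b) + ∑ S ∈ crossReps p, 0
      rw [R.nm_add, Finset.sum_const_zero, add_zero, ← RingHom.map_add, Ideal.Quotient.eq,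
        add_sub_cancel_left]
      exact Ideal.sum_mem _ fun S _ => ⟨_, rfl⟩

/-- The Tambara ideal `I` of the ghost of `R` is the ideal `(𝔭; 𝔮)`, which is `𝔭` in level `C_p/e`
and `𝔭^{C_p} × 𝔮` in level `C_p/C_p`. -/
def IsGhostPair {p : ℕ} [Fact p.Prime] {R : CpTambara.{u} p} (I : TIdeal R.ghost)
    (𝔭 : Ideal R.lvlE) (𝔮 : Ideal R.geomFixed) : Prop :=
  I.idealE = 𝔭 ∧ I.idealG = Ideal.prod (𝔭.comap R.fixedE.subtype) 𝔮

/-- `C_p`-prime ideals of a commutative ring with `C_p`-action. -/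
def IsCpPrime (p : ℕ) {B : Type u} [CommRing B] [MulSemiringAction (Cp p) B]
    (𝔭 : Ideal B) : Prop :=
  𝔭 ≠ ⊤ ∧ (∀ (g : Cp p), ∀ x ∈ 𝔭, g • x ∈ 𝔭) ∧
    ∀ x y : B, (∀ g : Cp p, x * g • y ∈ 𝔭) → x ∈ 𝔭 ∨ y ∈ 𝔭

end CpTambara

/-! In the ghost, restriction is the first projection, so a contraction from the coinduction, being
determined by its restriction, puts no condition on the `Φ` coordinate: points of the stratum are
pairs `(𝔭; Φ)`, with `𝔭` the intersection of the conjugates of a prime ideal. Such intersections are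
exactly the `C_p`-prime ideals (`specRes_idealE_isCpPrime`, `IsCpPrime.exists_isPrime`), and a prime
`(𝔭; Φ)` has `𝔭` `C_p`-prime (`IsGhostPair.isCpPrime`). This gives the description of the stratum.

Modulo transfers the norm is additive, hence a ring map `R(C_p/e) → Φ`. If `Φ ≠ 0`, a maximal ideal
`𝔮` of `Φ` with contraction `𝔭` yields a prime `(𝔭; 𝔮)` outside the stratum and below the point `(𝔭;
Φ)` of it. Open sets are stable under passing to smaller primes, so the stratum is not open.

The stratum is closed because it equals `V((0; Φ))`. The content is that a prime containing `(0; Φ)`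
is automatically a pair (`isGhostPair_of_botTopPair_le`). -/

namespace CpTambara

variable {p : ℕ} [Fact p.Prime]

/-! ### `C_p`-prime ideals and intersections of conjugates of primes -/

/-- Every `C_p`-prime ideal is the intersection of the conjugates of a prime ideal. -/
theorem IsCpPrime.exists_isPrime {B : Type u} [CommRing B] [MulSemiringAction (Cp p) B]
    {𝔭 : Ideal B} (h : IsCpPrime p 𝔭) :
    ∃ 𝔯 : Ideal B, 𝔯.IsPrime ∧ ∀ x, x ∈ 𝔭 ↔ ∀ g : Cp p, g • x ∈ 𝔯 := by
  obtain ⟨htop, hinv, hmul⟩ := h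
  -- Zorn is applied to the ideals above `𝔭` whose conjugates intersect inside `𝔭`; a maximal one
  -- turns out to be prime.
  obtain ⟨m, -, hm⟩ := zorn_le_nonempty₀
    {J : Ideal B | 𝔭 ≤ J ∧ ∀ x, (∀ g : Cp p, g • x ∈ J) → x ∈ 𝔭} (by
      intro c hcS hc J₀ hJ₀
      refine ⟨sSup c, ⟨(hcS hJ₀).1.trans (le_sSup hJ₀), fun x hx => ?_⟩, fun J hJ => le_sSup hJ⟩
      have hdir := hc.directedOn
      have hx' : ∀ g : Cp p, ∃ J : c, g • x ∈ J.1 := fun g => by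
        obtain ⟨J, hJ, hgJ⟩ := (Submodule.mem_sSup_of_directed ⟨J₀, hJ₀⟩ hdir).1 (hx g)
        exact ⟨⟨J, hJ⟩, hgJ⟩
      choose f hf using hx'
      have : Nonempty c := ⟨⟨J₀, hJ₀⟩⟩
      -- As `C_p` is finite, the memberships of all conjugates of `x` in the union hold in a single
      -- member of the chain.
      obtain ⟨z, hz⟩ := (directedOn_iff_directed.1 hdir).finite_le f
      exact (hcS z.2).2 x fun g => hz g (hf g)) 𝔭
    ⟨le_rfl, fun x hx => by simpa using hx 1⟩
  obtain ⟨⟨hle, hmS⟩, hmax⟩ := hm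
  have hext : ∀ a ∉ m, ∃ x ∉ 𝔭, ∀ g : Cp p, g • x ∈ Ideal.span {a} ⊔ m := by
    intro a ha
    by_contra! hcon
    refine ha (hmax ⟨hle.trans le_sup_right, fun x hx => ?_⟩ le_sup_right
      (Ideal.mem_sup_left (Ideal.mem_span_singleton_self a)))
    by_contra hxp
    obtain ⟨g, hg⟩ := hcon x hxp
    exact hg (hx g)
  refine ⟨m, ⟨?_, ?_⟩, fun x => ⟨fun hx g => hle (hinv g x hx), hmS x⟩⟩
  · rintro rfl
    exact htop ((Ideal.eq_top_iff_one _).2 (hmS 1 fun _ => Submodule.mem_top))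
  · intro a b hab
    by_contra! hcon
    obtain ⟨x, hxp, hx⟩ := hext a hcon.1
    obtain ⟨y, hyp, hy⟩ := hext b hcon.2
    -- Each conjugate of `x * k • y` lies in `(m + (a)) * (m + (b))`, which is inside `m` because `a
    -- * b` is.
    refine (hmul x y fun k => hmS _ fun g => ?_).elim hxp hyp
    rw [smul_mul', smul_smul]
    obtain ⟨s, u, hu, hs⟩ := Ideal.mem_span_singleton_sup.1 (hx g)
    obtain ⟨t, v, hv, ht⟩ := Ideal.mem_span_singleton_sup.1 (hy (g * k))
    rw [← hs, ← ht]
    have e : (s * a + u) * (t * b + v) = s * t * (a * b) + s * a * v + (t * b + v) * u := by ring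
    rw [e]
    exact m.add_mem (m.add_mem (m.mul_mem_left _ hab) (m.mul_mem_left _ hv))
      (m.mul_mem_left _ hu)

/-! ### Contractions from the coinduction -/

theorem mem_specRes_idealE {T : CpTambara.{u} p} {𝔯 : PrimeSpectrum T.lvlE} {x : T.lvlE} :
    x ∈ (T.specRes 𝔯).ideal.idealE ↔ ∀ g : Cp p, g • x ∈ 𝔯.asIdeal :=
  Iff.rfl

theorem mem_specRes_idealG {T : CpTambara.{u} p} {𝔯 : PrimeSpectrum T.lvlE} {x : T.lvlG} :
    x ∈ (T.specRes 𝔯).ideal.idealG ↔ T.res x ∈ 𝔯.asIdeal :=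
  Iff.rfl

/-- Restrictions are fixed by `C_p`, so the conditions for the various conjugates collapse to one.
Hence level `C_p/C_p` of a contraction is determined by level `C_p/e`. -/
theorem mem_specRes_idealG_iff_res {T : CpTambara.{u} p} {𝔯 : PrimeSpectrum T.lvlE}
    {x : T.lvlG} :
    x ∈ (T.specRes 𝔯).ideal.idealG ↔ T.res x ∈ (T.specRes 𝔯).ideal.idealE := by
  simp [mem_specRes_idealE, mem_specRes_idealG, T.smul_res]

theorem specRes_idealE_isCpPrime (T : CpTambara.{u} p) (𝔯 : PrimeSpectrum T.lvlE) :
    IsCpPrime p (T.specRes 𝔯).ideal.idealE := by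
  have h𝔯 := 𝔯.isPrime
  refine ⟨fun h => ?_, (T.specRes 𝔯).ideal.smul_mem, fun x y hxy => ?_⟩
  · have h1 : (1 : T.lvlE) ∈ (T.specRes 𝔯).ideal.idealE := h ▸ Submodule.mem_top
    have h1' := mem_specRes_idealE.1 h1 1
    rw [smul_one] at h1'
    exact h𝔯.ne_top ((Ideal.eq_top_iff_one _).2 h1')
  · by_contra! hcon
    simp only [mem_specRes_idealE, not_forall] at hcon hxy
    obtain ⟨⟨g, hg⟩, ⟨k, hk⟩⟩ := hcon
    -- The index `g⁻¹ * k` is chosen so that translating by `g` gives the product of `g • x` and `k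
    -- • y`.
    have h := hxy (g⁻¹ * k) g
    rw [smul_mul', smul_smul, mul_inv_cancel_left] at h
    exact (h𝔯.mem_or_mem h).elim hg hk

/-! ### Pairs `(𝔭; 𝔮)` and the points of the stratum -/

/-- The Tambara ideal of the ghost of `R` with given components. -/
def ghostIdeal (R : CpTambara.{u} p) (A : Ideal R.lvlE) (c : Ideal R.fixedE)
    (q : Ideal R.geomFixed) (htr : ∀ x ∈ A, (R.ghost.tr x).1 ∈ c)
    (hnm : ∀ x ∈ A, (R.ghost.nm x).1 ∈ c)
    (hnmq : ∀ x ∈ A, Ideal.Quotient.mk R.trIdeal (R.nm x) ∈ q)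
    (hc : ∀ x ∈ c, (x : R.lvlE) ∈ A) (hA : ∀ (g : Cp p), ∀ x ∈ A, g • x ∈ A) :
    TIdeal R.ghost where
  idealG := Ideal.prod c q
  idealE := A
  tr_mem x hx := (Ideal.mem_prod _ _).2 ⟨htr x hx, q.zero_mem⟩
  nm_mem x hx := (Ideal.mem_prod _ _).2 ⟨hnm x hx, hnmq x hx⟩
  res_mem x hx := hc x.1 ((Ideal.mem_prod _ _).1 hx).1
  smul_mem := hA

/-- The Tambara ideal `(A; q)` of the ghost of `R`. -/
def ghostPair (R : CpTambara.{u} p) (A : Ideal R.lvlE) (q : Ideal R.geomFixed)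
    (hnmq : ∀ x ∈ A, Ideal.Quotient.mk R.trIdeal (R.nm x) ∈ q)
    (hA : ∀ (g : Cp p), ∀ x ∈ A, g • x ∈ A) : TIdeal R.ghost :=
  ghostIdeal R A (A.comap R.fixedE.subtype) q
    (fun x hx => A.sum_mem fun g _ => hA g x hx)
    (fun x hx => A.prod_mem (Finset.mem_univ (1 : Cp p)) (hA 1 x hx))
    hnmq (fun _ hx => hx) hA

theorem IsGhostPair.ideal_eq {R : CpTambara.{u} p} {I J : TIdeal R.ghost} {A : Ideal R.lvlE}
    {q : Ideal R.geomFixed} (hI : IsGhostPair I A q) (hJ : IsGhostPair J A q) : I = J :=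
  TIdeal.ext (hI.2.trans hJ.2.symm) (hI.1.trans hJ.1.symm)

/-- Restriction in the ghost forgets the `Φ` coordinate, which is therefore unconstrained in a
contraction. -/
theorem isGhostPair_specRes (R : CpTambara.{u} p) (𝔯 : PrimeSpectrum R.ghost.lvlE) :
    IsGhostPair (R.ghost.specRes 𝔯).ideal (R.ghost.specRes 𝔯).ideal.idealE ⊤ := by
  refine ⟨rfl, Ideal.ext fun x => mem_specRes_idealG_iff_res.trans ?_⟩
  exact ⟨fun h => (Ideal.mem_prod _ _).2 ⟨h, Submodule.mem_top⟩,
    fun h => ((Ideal.mem_prod _ _).1 h).1⟩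

theorem exists_specRes_isGhostPair (R : CpTambara.{u} p) {𝔭 : Ideal R.lvlE}
    (h : IsCpPrime p 𝔭) :
    ∃ 𝔯 : PrimeSpectrum R.ghost.lvlE, IsGhostPair (R.ghost.specRes 𝔯).ideal 𝔭 ⊤ := by
  obtain ⟨𝔯, h𝔯, hmem⟩ := h.exists_isPrime
  refine ⟨⟨𝔯, h𝔯⟩, ?_⟩
  have e : (R.ghost.specRes ⟨𝔯, h𝔯⟩).ideal.idealE = 𝔭 := Ideal.ext fun x => (hmem x).symm
  have := isGhostPair_specRes R ⟨𝔯, h𝔯⟩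
  rwa [e] at this

theorem mem_eStratum_ghost_iff (R : CpTambara.{u} p) (P : R.ghost.Spec) :
    P ∈ R.ghost.eStratum ↔
      ∃ 𝔭 : Ideal R.lvlE, IsCpPrime p 𝔭 ∧ IsGhostPair P.ideal 𝔭 ⊤ := by
  constructor
  · rintro ⟨𝔯, rfl⟩
    exact ⟨_, specRes_idealE_isCpPrime R.ghost 𝔯, isGhostPair_specRes R 𝔯⟩
  · rintro ⟨𝔭, h𝔭, hP⟩
    obtain ⟨𝔯, h𝔯⟩ := exists_specRes_isGhostPair R h𝔭
    refine ⟨𝔯, ?_⟩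
    obtain ⟨I, hI⟩ := P
    have e : (R.ghost.specRes 𝔯).ideal = I := h𝔯.ideal_eq hP
    subst e
    rfl

/-! ### From prime pairs `(𝔭; Φ)` to `C_p`-prime ideals -/

/-- The ideal generated by the `C_p`-orbit of an element. -/
def orbitIdeal (p : ℕ) [Fact p.Prime] {B : Type u} [CommRing B] [MulSemiringAction (Cp p) B]
    (x : B) : Ideal B :=
  Ideal.span (Set.range fun g : Cp p => g • x)

theorem mem_orbitIdeal_self {B : Type u} [CommRing B] [MulSemiringAction (Cp p) B] (x : B) :
    x ∈ orbitIdeal p x :=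
  Ideal.subset_span ⟨1, one_smul _ x⟩

theorem smul_mem_orbitIdeal {B : Type u} [CommRing B] [MulSemiringAction (Cp p) B] (x : B)
    (g : Cp p) (y : B) (hy : y ∈ orbitIdeal p x) : g • y ∈ orbitIdeal p x := by
  have hle : orbitIdeal p x ≤
      (orbitIdeal p x).comap (MulSemiringAction.toRingHom (Cp p) B g) := by
    refine Ideal.span_le.2 ?_
    rintro _ ⟨k, rfl⟩
    exact Ideal.subset_span ⟨g * k, mul_smul g k x⟩
  exact hle hy

/-- A product of generators `g • x * k • y` is the translate by `g` of `x * (g⁻¹ * k) • y`. This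
turns the elementwise hypothesis of `C_p`-primality into a product of invariant ideals, on which a
prime Tambara ideal can be tested. -/
theorem orbitIdeal_mul_le {B : Type u} [CommRing B] [MulSemiringAction (Cp p) B] {𝔭 : Ideal B}
    (hinv : ∀ (g : Cp p), ∀ x ∈ 𝔭, g • x ∈ 𝔭) {x y : B} (hxy : ∀ g : Cp p, x * g • y ∈ 𝔭) :
    orbitIdeal p x * orbitIdeal p y ≤ 𝔭 := by
  unfold orbitIdeal
  rw [Ideal.span_mul_span', Ideal.span_le]
  rintro _ ⟨_, ⟨g, rfl⟩, _, ⟨k, rfl⟩, rfl⟩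
  have h := hinv g _ (hxy (g⁻¹ * k))
  rwa [smul_mul', smul_smul, mul_inv_cancel_left] at h

/-- If `(𝔭; Φ)` is prime then `𝔭` is `C_p`-prime. -/
theorem IsGhostPair.isCpPrime {R : CpTambara.{u} p} {P : TIdeal R.ghost} (hP : P.IsPrime)
    {𝔭 : Ideal R.lvlE} (h : IsGhostPair P 𝔭 ⊤) : IsCpPrime p 𝔭 := by
  obtain ⟨hE, hG⟩ := h
  have hinv : ∀ (g : Cp p), ∀ x ∈ 𝔭, g • x ∈ 𝔭 := by
    rw [← hE]
    exact P.smul_mem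
  refine ⟨?_, hinv, fun x y hxy => ?_⟩
  · rintro rfl
    refine hP.1 (TIdeal.ext ?_ hE)
    rw [hG]
    exact (Ideal.eq_top_iff_one _).2 ((Ideal.mem_prod _ _).2 ⟨Submodule.mem_top, Submodule.mem_top⟩)
  · have hle : ∀ z : R.lvlE, ghostPair R (orbitIdeal p z) ⊤ (fun _ _ => Submodule.mem_top)
        (smul_mem_orbitIdeal z) ≤ P → z ∈ 𝔭 := by
      intro z hz
      rw [← hE]
      exact hz.2 (mem_orbitIdeal_self z)
    -- Taking `Φ` as second component meets the norm condition for free and costs nothing, since the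
    -- second component of `P` is also `Φ`.
    refine (hP.2 (ghostPair R (orbitIdeal p x) ⊤ (fun _ _ => Submodule.mem_top)
      (smul_mem_orbitIdeal x)) (ghostPair R (orbitIdeal p y) ⊤ (fun _ _ => Submodule.mem_top)
      (smul_mem_orbitIdeal y)) (TIdeal.mul_le_iff.2 ?_)).imp (hle x) (hle y)
    have hmul := orbitIdeal_mul_le hinv hxy
    rw [hE, hG]
    refine ⟨Ideal.mul_le.2 fun a ha b hb => ?_, hmul⟩
    exact (Ideal.mem_prod _ _).2 ⟨hmul (Ideal.mul_mem_mul ((Ideal.mem_prod _ _).1 ha).1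
      ((Ideal.mem_prod _ _).1 hb).1), Submodule.mem_top⟩

theorem IsGhostPair.mem_eStratum_iff {R : CpTambara.{u} p} {P : R.ghost.Spec}
    {𝔭 : Ideal R.lvlE} {𝔮 : Ideal R.geomFixed} (h : IsGhostPair P.ideal 𝔭 𝔮) :
    P ∈ R.ghost.eStratum ↔ 𝔮 = ⊤ := by
  constructor
  · rintro ⟨𝔯, rfl⟩
    -- The element `(0, 1)` restricts to zero, so it lies in every contraction.
    have h1 : ((0, 1) : R.fixedE × R.geomFixed) ∈ (R.ghost.specRes 𝔯).ideal.idealG :=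
      mem_specRes_idealG.2 𝔯.asIdeal.zero_mem
    rw [h.2] at h1
    exact (Ideal.eq_top_iff_one _).2 ((Ideal.mem_prod _ _).1 h1).2
  · rintro rfl
    exact (mem_eStratum_ghost_iff R P).2 ⟨𝔭, h.isCpPrime P.isPrime, h⟩

/-! ### Contraction along the norm, and failure of openness -/

/-- The norm followed by the projection to `R(C_p/C_p)/Tr` is a ring homomorphism. -/
def nmGeom (R : CpTambara.{u} p) : R.lvlE →+* R.geomFixed where
  toFun x := Ideal.Quotient.mk R.trIdeal (R.nm x)
  map_one' := by rw [map_one, map_one]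
  map_mul' x y := by rw [map_mul, map_mul]
  map_zero' := by rw [R.nm_zero, map_zero]
  map_add' x y := by
    -- The cross terms in the norm of a sum are transfers, so they vanish in `Φ`.
    rw [R.nm_add, ← RingHom.map_add, Ideal.Quotient.eq, add_sub_cancel_left]
    exact Ideal.sum_mem _ fun S _ => ⟨_, rfl⟩

/-- The Tambara ideal `(𝔭; 𝔮)` where `𝔭` is the contraction of `𝔮` along the norm. -/
def nmGhostPair (R : CpTambara.{u} p) (𝔮 : Ideal R.geomFixed) : TIdeal R.ghost :=
  ghostPair R (𝔮.comap R.nmGeom) 𝔮 (fun _ hx => hx) fun g x hx => by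
    change Ideal.Quotient.mk R.trIdeal (R.nm (g • x)) ∈ 𝔮
    rw [R.nm_smul]
    exact hx

/-- The `Φ` coordinate alone detects containment. If all `Φ` coordinates of `K` lie in `𝔮`, its
norms place level `C_p/e` in the contraction of `𝔮`, and its restrictions then control the first
coordinate. Primality thus reduces to that of `𝔮`. -/
theorem nmGhostPair_isPrime (R : CpTambara.{u} p) (𝔮 : Ideal R.geomFixed) [h𝔮 : 𝔮.IsPrime] :
    (nmGhostPair R 𝔮).IsPrime := by
  have hG : ∀ x : R.ghost.lvlG, x ∈ (nmGhostPair R 𝔮).idealG ↔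
      R.ghost.res x ∈ (nmGhostPair R 𝔮).idealE ∧ x.2 ∈ 𝔮 := fun x => Ideal.mem_prod _ _
  refine ⟨fun h => ?_, fun I J hIJ => ?_⟩
  · have h1 : (1 : R.ghost.lvlG) ∈ (nmGhostPair R 𝔮).idealG := h ▸ Submodule.mem_top
    exact h𝔮.ne_top ((Ideal.eq_top_iff_one _).2 ((hG 1).1 h1).2)
  · have key : ∀ K : TIdeal R.ghost, ¬ K ≤ nmGhostPair R 𝔮 → ∃ x ∈ K.idealG, x.2 ∉ 𝔮 := by
      intro K hK
      by_contra! hcon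
      have hE : K.idealE ≤ (nmGhostPair R 𝔮).idealE := fun x hx => hcon _ (K.nm_mem x hx)
      exact hK ⟨fun x hx => (hG x).2 ⟨hE (K.res_mem x hx), hcon x hx⟩, hE⟩
    by_contra! hcon
    obtain ⟨x, hx, hx'⟩ := key I hcon.1
    obtain ⟨y, hy, hy'⟩ := key J hcon.2
    have hxy := (hG _).1 ((TIdeal.mul_le_iff.1 hIJ).1 (Ideal.mul_mem_mul hx hy))
    exact (h𝔮.mem_or_mem hxy.2).elim hx' hy'

/-- Open subsets of the Nakaoka spectrum are stable under passage to smaller primes. -/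
theorem mem_of_isOpen_of_le {T : CpTambara.{u} p} {U : Set T.Spec} (hU : IsOpen U)
    {P Q : T.Spec} (hPQ : P.ideal ≤ Q.ideal) (hQ : Q ∈ U) : P ∈ U := by
  induction hU with
  | basic s hs =>
    obtain ⟨I, rfl⟩ := hs
    exact fun hP => hQ (le_trans hP hPQ)
  | univ => trivial
  | inter s t _ _ ihs iht => exact ⟨ihs hQ.1, iht hQ.2⟩
  | sUnion S _ ih =>
    obtain ⟨s, hs, hQs⟩ := hQ
    exact ⟨s, hs, ih s hs hQs⟩

theorem isClosed_zeroLocus {T : CpTambara.{u} p} (I : TIdeal T) : IsClosed (zeroLocus I) :=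
  ⟨TopologicalSpace.isOpen_generateFrom_of_mem ⟨I, rfl⟩⟩

theorem not_isOpen_eStratum_ghost (R : CpTambara.{u} p) (h : ¬ Function.Surjective R.tr) :
    ¬ IsOpen R.ghost.eStratum := by
  intro hopen
  have hne : R.trIdeal ≠ ⊤ := fun he => h fun y => by
    have : y ∈ R.trIdeal := he ▸ Submodule.mem_top
    exact this
  have : Nontrivial R.geomFixed := Ideal.Quotient.nontrivial_iff.2 hne
  obtain ⟨𝔮, h𝔮⟩ := Ideal.exists_maximal R.geomFixed
  have := h𝔮.isPrime
  let P : R.ghost.Spec := ⟨nmGhostPair R 𝔮, nmGhostPair_isPrime R 𝔮⟩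
  have hP : IsGhostPair P.ideal (𝔮.comap R.nmGeom) 𝔮 := ⟨rfl, rfl⟩
  have hprime : (𝔮.comap R.nmGeom).IsPrime := inferInstance
  have hinv : ∀ (g : Cp p), ∀ x ∈ 𝔮.comap R.nmGeom, g • x ∈ 𝔮.comap R.nmGeom :=
    (nmGhostPair R 𝔮).smul_mem
  -- An invariant prime ideal is `C_p`-prime: the condition at `g = 1` suffices.
  have hCp : IsCpPrime p (𝔮.comap R.nmGeom) := by
    refine ⟨hprime.ne_top, hinv, fun x y hxy => hprime.mem_or_mem ?_⟩
    simpa using hxy 1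
  obtain ⟨𝔯, h𝔯⟩ := exists_specRes_isGhostPair R hCp
  have hle : P.ideal ≤ (R.ghost.specRes 𝔯).ideal := by
    refine ⟨?_, ?_⟩
    · rw [hP.2, h𝔯.2]
      exact fun x hx => (Ideal.mem_prod _ _).2 ⟨((Ideal.mem_prod _ _).1 hx).1, Submodule.mem_top⟩
    · exact (hP.1.trans h𝔯.1.symm).le
  exact h𝔮.ne_top (hP.mem_eStratum_iff.1 (mem_of_isOpen_of_le hopen hle ⟨𝔯, rfl⟩))

/-! ### Closedness: the stratum as `V((0; Φ))` -/

/-- The Tambara ideal `(0; Φ)`. -/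
def botTopPair (R : CpTambara.{u} p) : TIdeal R.ghost :=
  ghostPair R ⊥ ⊤ (fun _ _ => Submodule.mem_top) fun g x hx => by
    rw [Ideal.mem_bot] at hx ⊢
    rw [hx, smul_zero]

/-- Every prime ideal of the ghost containing `(0; Φ)` is of the form `(𝔭; Φ)`. The norm of a fixed
point `x` is `x ^ p` in the first component, which forces the fixed points of `𝔭` to lie in the
prime. -/
theorem isGhostPair_of_botTopPair_le {R : CpTambara.{u} p} {P : TIdeal R.ghost}
    (hP : P.IsPrime) (h : botTopPair R ≤ P) : IsGhostPair P P.idealE ⊤ := by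
  have hbot : ∀ b : R.geomFixed, ((0, b) : R.fixedE × R.geomFixed) ∈ P.idealG := fun b =>
    h.1 ((Ideal.mem_prod _ _).2 ⟨Ideal.zero_mem _, Submodule.mem_top⟩)
  -- Since `P` contains `0 × Φ`, its level `C_p/C_p` is `a × Φ`; it remains to show that `a`
  -- contains all fixed points of `P.idealE`.
  let a : Ideal R.fixedE := P.idealG.map (RingHom.fst R.fixedE R.geomFixed)
  have ha : ∀ x : R.fixedE × R.geomFixed, x.1 ∈ a ↔ x ∈ P.idealG := by
    intro x
    constructor
    · intro hx
      obtain ⟨y, hy, hyx⟩ :=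
        (Ideal.mem_map_iff_of_surjective _ (fun z => ⟨(z, 0), rfl⟩)).1 hx
      have e : x = y + (0, x.2 - y.2) := by
        refine Prod.ext ?_ ?_
        · change x.1 = y.1 + 0
          rw [add_zero]
          exact hyx.symm
        · exact (add_sub_cancel _ _).symm
      rw [e]
      exact P.idealG.add_mem hy (hbot _)
    · exact fun hx => Ideal.mem_map_of_mem (RingHom.fst R.fixedE R.geomFixed) hx
  have hres : ∀ x ∈ a, (x : R.lvlE) ∈ P.idealE := fun x hx =>
    P.res_mem (x, 0) ((ha (x, 0)).1 hx)
  -- Primality of `P` is tested on enlargements of `P` that add `x` or `y` to `a` and keep level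
  -- `C_p/e`. These are Tambara ideals because `a` already contains the needed transfers and norms,
  -- while `x` and `y` lie in `P.idealE`; at level `C_p/e` the product condition is automatic.
  have hmul : ∀ x y : R.fixedE, (x : R.lvlE) ∈ P.idealE → (y : R.lvlE) ∈ P.idealE → x * y ∈ a →
      x ∈ a ∨ y ∈ a := by
    have hsup : ∀ x : R.fixedE, (x : R.lvlE) ∈ P.idealE → ∀ z ∈ a ⊔ Ideal.span {x},
        (z : R.lvlE) ∈ P.idealE := by
      intro x hx
      have hle : a ⊔ Ideal.span {x} ≤ Ideal.comap R.fixedE.subtype P.idealE :=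
        sup_le hres ((Ideal.span_singleton_le_iff_mem _).2 hx)
      exact hle
    let K : ∀ x : R.fixedE, (x : R.lvlE) ∈ P.idealE → TIdeal R.ghost := fun x hx =>
      ghostIdeal R P.idealE (a ⊔ Ideal.span {x}) ⊤
        (fun z hz => Ideal.mem_sup_left ((ha _).2 (P.tr_mem z hz)))
        (fun z hz => Ideal.mem_sup_left ((ha _).2 (P.nm_mem z hz)))
        (fun _ _ => Submodule.mem_top) (hsup x hx) P.smul_mem
    have hK : ∀ (x : R.fixedE) (hx : (x : R.lvlE) ∈ P.idealE), K x hx ≤ P → x ∈ a :=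
      fun x hx hle => (ha (x, 0)).2 (hle.1 ((Ideal.mem_prod _ _).2
        ⟨Ideal.mem_sup_right (Ideal.mem_span_singleton_self x), Submodule.mem_top⟩))
    intro x y hx hy hxy
    refine (hP.2 (K x hx) (K y hy) (TIdeal.mul_le_iff.2 ⟨?_, Ideal.mul_le_left⟩)).imp
      (hK x hx) (hK y hy)
    refine Ideal.mul_le.2 fun s hs t ht => (ha _).1 ?_
    have hle : (a ⊔ Ideal.span {x}) * (a ⊔ Ideal.span {y}) ≤ a := by
      rw [Ideal.sup_mul, Ideal.mul_sup (Ideal.span {x})]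
      refine sup_le Ideal.mul_le_left (sup_le Ideal.mul_le_right ?_)
      rw [Ideal.span_singleton_mul_span_singleton, Ideal.span_singleton_le_iff_mem]
      exact hxy
    exact hle (Ideal.mul_mem_mul ((Ideal.mem_prod _ _).1 hs).1 ((Ideal.mem_prod _ _).1 ht).1)
  -- `hmul` covers only fixed points lying in `P.idealE`, but all positive powers of such an `x` are
  -- of this kind, so `a` is radical for them.
  have hpow : ∀ (x : R.fixedE), (x : R.lvlE) ∈ P.idealE → ∀ n : ℕ, x ^ (n + 1) ∈ a → x ∈ a := by
    intro x hx n
    induction n with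
    | zero => simp
    | succ n ih =>
      intro hn
      rw [pow_succ] at hn
      refine (hmul _ _ ?_ hx hn).elim ih id
      rw [pow_succ]
      exact P.idealE.mul_mem_left _ hx
  refine ⟨rfl, Ideal.ext fun x => ⟨fun hx => (Ideal.mem_prod _ _).2
    ⟨P.res_mem x hx, Submodule.mem_top⟩, fun hx => (ha x).1 ?_⟩⟩
  have hx1 : (x.1 : R.lvlE) ∈ P.idealE := ((Ideal.mem_prod _ _).1 hx).1
  -- `hpow` uses the exponent `n + 1`, so `p - 1` yields the `p`-th power, which is the first
  -- coordinate of the norm.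
  refine hpow x.1 hx1 (p - 1) ?_
  rw [Nat.sub_add_cancel (Fact.out : p.Prime).one_le]
  have hnm := (ha _).2 (P.nm_mem _ hx1)
  have e : (R.ghost.nm (x.1 : R.lvlE)).1 = x.1 ^ p := by
    refine Subtype.ext ?_
    change ∏ g : Cp p, g • (x.1 : R.lvlE) = (x.1 : R.lvlE) ^ p
    rw [Finset.prod_congr rfl fun g _ => x.1.2 g, Finset.prod_const, Finset.card_univ]
    simp
  rwa [e] at hnm

/-- Every point of the stratum has second component `Φ`, so contains `(0; Φ)`. Conversely, a prime
containing `(0; Φ)` is a pair with second component `Φ`, and such primes lie in the stratum. -/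
theorem eStratum_ghost_eq_zeroLocus (R : CpTambara.{u} p) :
    R.ghost.eStratum = zeroLocus (botTopPair R) := by
  ext P
  constructor
  · rintro ⟨𝔯, rfl⟩
    refine ⟨?_, bot_le⟩
    rw [(isGhostPair_specRes R 𝔯).2]
    exact fun x hx => (Ideal.mem_prod _ _).2
      ⟨Ideal.comap_mono bot_le ((Ideal.mem_prod _ _).1 hx).1, Submodule.mem_top⟩
  · exact fun h => (isGhostPair_of_botTopPair_le P.isPrime h).mem_eStratum_iff.2 rfl

theorem isClosed_eStratum_ghost (R : CpTambara.{u} p) : IsClosed R.ghost.eStratum :=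
  eStratum_ghost_eq_zeroLocus R ▸ isClosed_zeroLocus _

end CpTambara

theorem mainTheorem5 {p : ℕ} [Fact p.Prime] (R : CpTambara.{u} p) (hR : R.IsNonzero) :
    ((∀ (P : R.ghost.Spec) (𝔭 : Ideal R.lvlE) (𝔮 : Ideal R.geomFixed),
        CpTambara.IsGhostPair P.ideal 𝔭 𝔮 → (P ∈ R.ghost.eStratum ↔ 𝔮 = ⊤)) ∧
      (∀ P : R.ghost.Spec, P ∈ R.ghost.eStratum ↔
        ∃ 𝔭 : Ideal R.lvlE, CpTambara.IsCpPrime p 𝔭 ∧ CpTambara.IsGhostPair P.ideal 𝔭 ⊤) ∧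
      (∀ 𝔭 : Ideal R.lvlE, CpTambara.IsCpPrime p 𝔭 →
        ∃ P : R.ghost.Spec, CpTambara.IsGhostPair P.ideal 𝔭 ⊤)) ∧
    (¬ Function.Surjective R.tr → ¬ IsOpen R.ghost.eStratum) ∧
    ((minimalPrimes R.fixedE).Finite → IsClosed R.ghost.eStratum) :=
  ⟨⟨fun _ _ _ h => h.mem_eStratum_iff, CpTambara.mem_eStratum_ghost_iff R, fun _ h𝔭 =>
      let ⟨𝔯, h𝔯⟩ := CpTambara.exists_specRes_isGhostPair R h𝔭
      ⟨R.ghost.specRes 𝔯, h𝔯⟩⟩,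
    CpTambara.not_isOpen_eStratum_ghost R, fun _ => CpTambara.isClosed_eStratum_ghost R⟩
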